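/- Setting. Let $\Lambda,N\ge 1$ be integers, let $L=(L_1,\dots,L_\Lambda)$ be positive integers with $K=\sum_\lambda L_\lambda\le N$, and let $t\in\{0,1,\dots,\Lambda\}$. A server holds a library of $N$ files, each consisting of $B$ bits and regarded as having unit size. It is connected by an error-free broadcast link, which carries one file per unit of time, to $K$ users. There are $\Lambda$ caches, cache $\lambda$ is accessible to exactly $L_\lambda$ of the users, and every user has access to exactly one cache. A memory allocation consists of cache sizes $M_\lambda\in[0,N]$ (in units of file) with $\sum_\lambda M_\lambda=tN$. An uncoded placement is a choice of $B\ge 1$ and, for each cache $\lambda$, of a set of bits of the library that cache $\lambda$ stores; it must satisfy that cache $\lambda$ stores at most $M_\lambda B$ bits. The placement is regular if every bit of the library is stored in the same number of caches. Afterwards each user requests one file, which gives a demand vector $d\in\{1,\dots,N\}^K$. A delivery scheme for $d$ broadcasts a string of $\ell$ bits that is an arbitrary function of the library, such that every user can recover its requested file without error, for every content of the library, from the broadcast string and the content of its cache. For a placement $\mathcal Z$, let $T^*(\mathcal Z,d,L)$ be the minimum of $\ell/B$ over all delivery schemes for $d$, and let $T^*_{\mathrm{reg}}(t,L)=\min_{\mathcal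 Z}\max_{d}T^*(\mathcal Z,d,L)$, where $\mathcal Z$ ranges over the regular uncoded placements for all memory allocations. (Memory allocation and placement may depend on $L$ but not on $d$; delivery may depend on $d$.) For a family $X$ of numbers let $e_k(X)$ be its $k$-th elementary symmetric function, with $e_0=1$, $e_{-1}=0$, and $e_k(X)=0$ if $k$ exceeds the number of members of $X$. Put $$\gamma_\lambda=\frac{L_\lambda\,e_{t-1}(L\setminus\{L_\lambda\})}{e_t(L)},\qquad T(t,L)=\frac{\sum_{\lambda=1}^{\Lambda}L_\lambda(1-\gamma_\lambda)}{t+1},$$ where $L\setminus\{L_\lambda\}$ is the family $L$ with the member of index $\lambda$ removed. Theorem. The minimum $T^*_{\mathrm{reg}}(t,L)$ exists, and $$T^*_{\mathrm{reg}}(t,L)=T(t,L)=\frac{e_{t+1}(L)}{e_t(L)}.$$ Moreover $M_\lambda=\gamma_\lambda N$ is a memory allocation, with $\gamma_\lambda>0$ for all $\lambda$ if $t\ge 1$, and the minimum is attained by a regular uncoded placement in which every cache $\lambda$ stores exactly $\gamma_\lambda N$ units of file. That is, the delivery time $T(t,L)$ is exactly optimal under uncoded and regular cache placement. -/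

import Mathlib

noncomputable section

namespace SharedCache

/-- The elementary symmetric function `e_k` of the family `(L c)`, `c ∈ s`. -/
def elemSymm {Λ : ℕ} (L : Fin Λ → ℕ) (s : Finset (Fin Λ)) (k : ℕ) : ℝ :=
  (s.val.map fun c => (L c : ℝ)).esymm k

/-- The normalized cache sizes `γ_c = L_c · e_{t-1}(L ∖ {L_c}) / e_t(L)`, with `e_{-1} = 0`. -/
def gamma {Λ : ℕ} (t : ℕ) (L : Fin Λ → ℕ) (c : Fin Λ) : ℝ :=
  match t with
  | 0 => 0
  | s + 1 => L c * elemSymm L (Finset.univ.erase c) s / elemSymm L Finset.univ (s + 1)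

/-- The delivery time `T(t, L) = (∑ c, L_c (1 - γ_c)) / (t + 1)`. -/
def achievableTime {Λ : ℕ} (t : ℕ) (L : Fin Λ → ℕ) : ℝ :=
  (∑ c, (L c : ℝ) * (1 - gamma t L c)) / ((t : ℝ) + 1)

/-- A library of `N` files of `B` bits each. -/
abbrev Library (N B : ℕ) : Type := Fin N → Fin B → Bool

/-- The users: cache `c` is connected to `L c` users, and no user to two caches. -/
abbrev User {Λ : ℕ} (L : Fin Λ → ℕ) : Type := (c : Fin Λ) × Fin (L c)

/-- A demand vector: the index of the file requested by each user. -/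
abbrev Demand {Λ : ℕ} (N : ℕ) (L : Fin Λ → ℕ) : Type := User L → Fin N

/-- An uncoded cache placement for `N` files and `Λ` caches: the number of bits into which a
(unit-sized) file is divided, and for every bit of the library the set of caches storing it. -/
structure Placement (N Λ : ℕ) where
  /-- the number of bits per file -/
  fileBits : ℕ
  fileBits_pos : 0 < fileBits
  /-- the caches that store a given bit of a given file -/
  stored : Fin N → Fin fileBits → Finset (Fin Λ)

namespace Placement

variable {N Λ : ℕ}

/-- The positions (file, bit) of the library that are stored in cache `c`. -/
def bitsOf (Z : Placement N Λ) (c : Fin Λ) : Finset (Fin N × Fin Z.fileBits) :=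
  Finset.univ.filter fun p => c ∈ Z.stored p.1 p.2

/-- The amount of content of cache `c`, in units of file. -/
def load (Z : Placement N Λ) (c : Fin Λ) : ℝ :=
  ((Z.bitsOf c).card : ℝ) / (Z.fileBits : ℝ)

/-- Every bit of the library is stored in the same number of caches. -/
def IsRegular (Z : Placement N Λ) : Prop :=
  ∃ r : ℕ, ∀ n b, (Z.stored n b).card = r

/-- The content of cache `c` when the library is `W`. -/
def content (Z : Placement N Λ) (W : Library N Z.fileBits) (c : Fin Λ) :
    {p // p ∈ Z.bitsOf c} → Bool :=
  fun p => W p.1.1 p.1.2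

/-- A delivery scheme for the demand `d` that broadcasts `ℓ` bits: an arbitrary encoding of the
library by the server, and for each user an arbitrary decoding map from the broadcast message and
the content of its cache, such that every user always recovers the requested file. -/
structure DeliveryScheme (Z : Placement N Λ) (L : Fin Λ → ℕ) (d : Demand N L) (ℓ : ℕ) where
  /-- the broadcast message -/
  encode : Library N Z.fileBits → Fin ℓ → Bool
  /-- the decoding map of each user -/
  decode : (u : User L) → (Fin ℓ → Bool) → ({p // p ∈ Z.bitsOf u.1} → Bool) →
    Fin Z.fileBits → Bool
  correct : ∀ W u, decode u (encode W) (Z.content W u.1) = W (d u)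

/-- The least number of bits that have to be broadcast to serve the demand `d`. -/
def minBits (Z : Placement N Λ) (L : Fin Λ → ℕ) (d : Demand N L) : ℕ :=
  sInf {ℓ | Nonempty (Z.DeliveryScheme L d ℓ)}

/-- Broadcasting the whole library is a delivery scheme, so `minBits` is a true minimum. -/
theorem minBits_spec (Z : Placement N Λ) (L : Fin Λ → ℕ) (d : Demand N L) :
    Nonempty (Z.DeliveryScheme L d (Z.minBits L d)) := by
  have h : {ℓ | Nonempty (Z.DeliveryScheme L d ℓ)}.Nonempty :=
    ⟨N * Z.fileBits, ⟨{
      encode := fun W i => W (finProdFinEquiv.symm i).1 (finProdFinEquiv.symm i).2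
      decode := fun u x _ b => x (finProdFinEquiv (d u, b))
      correct := fun W u => by funext b; simp }⟩⟩
  exact Nat.sInf_mem h

/-- The minimum delivery time for the demand `d`; one file is sent per unit of time. -/
def deliveryTime (Z : Placement N Λ) (L : Fin Λ → ℕ) (d : Demand N L) : ℝ :=
  (Z.minBits L d : ℝ) / (Z.fileBits : ℝ)

/-- The worst-case delivery time: the maximum over the finitely many demand vectors. -/
def worstCaseTime (Z : Placement N Λ) (L : Fin Λ → ℕ) : ℝ :=
  ⨆ d : Demand N L, Z.deliveryTime L d

end Placement

/-- `M` is an allocation of the total memory `t * N` (in units of file) to the `Λ` caches. -/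
def IsMemoryAllocation {Λ : ℕ} (N t : ℕ) (M : Fin Λ → ℝ) : Prop :=
  (∀ c, 0 ≤ M c ∧ M c ≤ N) ∧ ∑ c, M c = t * N

/-- The worst-case delivery times, each under optimal delivery, of all regular uncoded placements
that fit into some memory allocation of total size `t * N`. -/
def regularUncodedTimes {Λ : ℕ} (N t : ℕ) (L : Fin Λ → ℕ) : Set ℝ :=
  {T | ∃ (M : Fin Λ → ℝ) (Z : Placement N Λ), IsMemoryAllocation N t M ∧
    (∀ c, Z.load c ≤ M c) ∧ Z.IsRegular ∧ T = Z.worstCaseTime L}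

end SharedCache

end

/-! Converse. Fix a ranking of the caches and pairwise distinct demands. Going through the users by
rank, each file decoded supplies what later users need from their caches, so the broadcast
determines all requested bits that are stored only at caches ranked after the requester's
(`card_le_of_deliveryScheme`). Averaging over cyclic shifts of the demand leaves, for each ranking,
a linear bound on the numbers of library bits stored exactly at each set of caches.
`subsetSum_mul_symmSum_le` combines the rankings, by recursion on the first cache, into the bound
e_{r+1}/e_r when every bit is stored r times. The memory constraint forces r ≤ t, and log-concavity
(`symmSum_mul_le`) makes r = t the weakest case.

Achievability. Split each file into one bit per choice of t users at distinct caches, so that the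
share of a set S of caches is proportional to the product of L over S. The e_t bits per file are
then delivered by one XOR for each of the e_{t+1} choices of t + 1 users at distinct caches
(`nonempty_deliveryScheme`). -/

noncomputable section

namespace SharedCache

/-! ### Elementary symmetric sums and the averaging over rankings. -/

section SymmetricSums

variable {ι : Type*}

/-- The sum of `f` over the subsets of `A` with `k` elements. -/
def subsetSum (f : Finset ι → ℝ) (A : Finset ι) (k : ℕ) : ℝ :=
  ∑ S ∈ A.powersetCard k, f S

/-- The elementary symmetric function of degree `k` of the family `x` restricted to `A`. -/
def symmSum (x : ι → ℝ) (A : Finset ι) (k : ℕ) : ℝ :=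
  subsetSum (fun S => ∏ c ∈ S, x c) A k

theorem symmSum_zero (x : ι → ℝ) (A : Finset ι) : symmSum x A 0 = 1 := by
  simp [symmSum, subsetSum]

theorem symmSum_eq_zero (x : ι → ℝ) {A : Finset ι} {k : ℕ} (h : A.card < k) :
    symmSum x A k = 0 := by
  simp [symmSum, subsetSum, Finset.powersetCard_eq_empty.2 h]

theorem symmSum_nonneg {x : ι → ℝ} (hx : ∀ c, 0 ≤ x c) (A : Finset ι) (k : ℕ) :
    0 ≤ symmSum x A k :=
  Finset.sum_nonneg fun _ _ => Finset.prod_nonneg fun c _ => hx c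

theorem symmSum_pos {x : ι → ℝ} (hx : ∀ c, 0 < x c) {A : Finset ι} {k : ℕ} (h : k ≤ A.card) :
    0 < symmSum x A k :=
  Finset.sum_pos (fun _ _ => Finset.prod_pos fun c _ => hx c) (Finset.powersetCard_nonempty.2 h)

variable [DecidableEq ι]

/-- Double counting: a k-subset of `A` survives the removal of exactly the `A.card - k` elements
outside it. -/
theorem sum_subsetSum_erase (f : Finset ι → ℝ) (A : Finset ι) (k : ℕ) :
    ∑ c ∈ A, subsetSum f (A.erase c) k = ((A.card : ℝ) - k) * subsetSum f A k := by
  have h1 : ∀ c ∈ A, subsetSum f (A.erase c) k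
      = ∑ S ∈ A.powersetCard k, if c ∈ S then 0 else f S := by
    intro c _
    simp only [subsetSum, ← ite_not (c ∈ _), ← Finset.sum_filter]
    refine Finset.sum_congr ?_ fun _ _ => rfl
    ext S
    simp only [Finset.mem_powersetCard, Finset.mem_filter, Finset.subset_erase]
    tauto
  rw [Finset.sum_congr rfl h1, Finset.sum_comm, subsetSum, Finset.mul_sum]
  refine Finset.sum_congr rfl fun S hS => ?_
  obtain ⟨hSA, hc⟩ := Finset.mem_powersetCard.1 hS
  simp only [← ite_not (_ ∈ S), ← Finset.sum_filter, Finset.sum_const, nsmul_eq_mul]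
  have : (A.filter fun c => c ∉ S) = A \ S := by ext; simp
  rw [this, Finset.cast_card_sdiff hSA, hc]

theorem symmSum_insert (x : ι → ℝ) {A : Finset ι} {c : ι} (hc : c ∉ A) (k : ℕ) :
    symmSum x (insert c A) (k + 1) = symmSum x A (k + 1) + x c * symmSum x A k := by
  unfold symmSum subsetSum
  rw [Finset.powersetCard_succ_insert hc, Finset.sum_union, Finset.sum_image, Finset.mul_sum]
  · congr 1
    refine Finset.sum_congr rfl fun S hS => ?_
    rw [Finset.prod_insert fun h => hc ((Finset.mem_powersetCard.1 hS).1 h)]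
  · intro S hS S' hS' h
    have h1 : c ∉ S := fun h => hc ((Finset.mem_powersetCard.1 hS).1 h)
    have h2 : c ∉ S' := fun h => hc ((Finset.mem_powersetCard.1 hS').1 h)
    rw [← Finset.erase_insert h1, ← Finset.erase_insert h2]
    exact congrArg (fun U => U.erase c) h
  · rw [Finset.disjoint_left]
    intro S hS hS'
    obtain ⟨U, -, rfl⟩ := Finset.mem_image.1 hS'
    exact hc ((Finset.mem_powersetCard.1 hS).1 (Finset.mem_insert_self c U))

theorem symmSum_erase (x : ι → ℝ) {A : Finset ι} {c : ι} (hc : c ∈ A) (k : ℕ) :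
    symmSum x A (k + 1) = symmSum x (A.erase c) (k + 1) + x c * symmSum x (A.erase c) k := by
  rw [← symmSum_insert x (Finset.notMem_erase c A), Finset.insert_erase hc]

theorem sum_mul_symmSum_erase (x : ι → ℝ) (A : Finset ι) (k : ℕ) :
    ∑ c ∈ A, x c * symmSum x (A.erase c) k = ((k : ℝ) + 1) * symmSum x A (k + 1) := by
  have h1 : ∀ c ∈ A, x c * symmSum x (A.erase c) k
      = symmSum x A (k + 1) - symmSum x (A.erase c) (k + 1) := fun c hc => by
    rw [symmSum_erase x hc]; ring
  have h2 := sum_subsetSum_erase (fun S => ∏ c ∈ S, x c) A (k + 1)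
  rw [Finset.sum_congr rfl h1, Finset.sum_sub_distrib, Finset.sum_const, nsmul_eq_mul]
  change ∑ c ∈ A, symmSum x (A.erase c) (k + 1) = _ * symmSum x A (k + 1) at h2
  rw [h2]; push_cast; ring

/-- The elementary symmetric functions of nonnegative numbers form a log-concave sequence. -/
theorem symmSum_mul_le {x : ι → ℝ} (hx : ∀ c, 0 ≤ x c) (A : Finset ι) :
    ∀ {i j : ℕ}, i ≤ j →
      symmSum x A i * symmSum x A (j + 1) ≤ symmSum x A (i + 1) * symmSum x A j := by
  induction A using Finset.induction_on with
  | empty =>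
    intro i j _
    rw [symmSum_eq_zero x (k := j + 1) (by simp), mul_zero]
    exact mul_nonneg (symmSum_nonneg hx _ _) (symmSum_nonneg hx _ _)
  | insert c A hc ih =>
    intro i j hij
    have h0 := symmSum_nonneg hx A
    rcases j with _ | j
    · obtain rfl : i = 0 := by omega
      rw [mul_comm]
    rcases i with _ | i
    · simp only [symmSum_insert x hc, symmSum_zero]
      have h1 := ih (i := 0) (j := j + 1) (by omega)
      rw [symmSum_zero] at h1
      nlinarith [mul_nonneg (hx c) (mul_nonneg (h0 1) (h0 j)), hx c, h0 j, h0 (j + 1),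
        mul_nonneg (mul_nonneg (hx c) (hx c)) (h0 j)]
    · simp only [symmSum_insert x hc]
      have h1 := ih (i := i + 1) (j := j + 1) (by omega)
      have h2 := ih (i := i) (j := j) (by omega)
      have h3 := ih (i := i) (j := j + 1) (by omega)
      -- After expansion in powers of `x c`, `h1` and `h2` compare the coefficients of degree 0 and
      -- 2. In degree 1 the common term e_{i+1} e_{j+1} cancels and this remains; for i < j it is a
      -- chain of two instances of the hypothesis, which is why the claim is made for all i ≤ j.
      have h4 : symmSum x A i * symmSum x A (j + 1 + 1)
          ≤ symmSum x A (i + 1 + 1) * symmSum x A j := by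
        rcases eq_or_lt_of_le hij with h | h
        · obtain rfl : i = j := by omega
          rw [mul_comm]
        · exact h3.trans (ih (by omega))
      nlinarith [mul_le_mul_of_nonneg_left h4 (hx c),
        mul_le_mul_of_nonneg_left h2 (mul_nonneg (hx c) (hx c))]

theorem symmSum_succ_div_antitone {x : ι → ℝ} (hx : ∀ c, 0 < x c) {A : Finset ι} {r t : ℕ}
    (hrt : r ≤ t) (ht : t ≤ A.card) :
    symmSum x A (t + 1) / symmSum x A t ≤ symmSum x A (r + 1) / symmSum x A r := by
  rw [div_le_div_iff₀ (symmSum_pos hx ht) (symmSum_pos hx (hrt.trans ht)), mul_comm]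
  exact symmSum_mul_le (fun c => (hx c).le) A hrt

/-- If, for every ranking of `A`, the total of `x c * a S` over the `r`-subsets `S` of `A` and the
elements `c` ranked before all of `S` is at most `T`, then the total mass of `a` is at most
`T * e_r / e_{r+1}`. -/
theorem subsetSum_mul_symmSum_le {x : ι → ℝ} (hx : ∀ c, 0 ≤ x c) {a : Finset ι → ℝ}
    (ha : ∀ S, 0 ≤ a S) (r : ℕ) (A : Finset ι) : ∀ T : ℝ,
    (∀ pos : ι → ℕ, ∑ c ∈ A, x c * ∑ S ∈ A.powersetCard r with ∀ s ∈ S, pos c < pos s, a S ≤ T) →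
    subsetSum a A r * symmSum x A (r + 1) ≤ T * symmSum x A r := by
  induction A using Finset.strongInduction with
  | H A ih =>
    intro T hT
    rcases Nat.lt_or_ge r A.card with hr | hr
    -- Ranking `j` first charges `x j` times the mass m of the sets avoiding `j` and leaves the
    -- budget T - x_j m for `A.erase j`. The recursion e_{r+1}(A) = e_{r+1}(A∖j) + x_j e_r(A∖j)
    -- absorbs that charge.
    · have key : ∀ j ∈ A, subsetSum a (A.erase j) r * symmSum x A (r + 1)
          ≤ T * symmSum x (A.erase j) r := by
        intro j hj
        have h := ih (A.erase j) (Finset.erase_ssubset hj)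
          (T - x j * subsetSum a (A.erase j) r) fun pos => by
            -- The shift by one makes `j` strictly first and keeps the order of the others.
            have h1 := hT (Function.update (fun c => pos c + 1) j 0)
            rw [← Finset.add_sum_erase A _ hj] at h1
            have e1 : (A.powersetCard r).filter (fun S => ∀ s ∈ S,
                Function.update (fun c => pos c + 1) j 0 j
                  < Function.update (fun c => pos c + 1) j 0 s)
                = (A.erase j).powersetCard r := by
              ext S
              simp only [Finset.mem_filter, Finset.mem_powersetCard, Finset.subset_erase,
                Function.update_self]
              constructor
              · rintro ⟨⟨h1, h2⟩, h3⟩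
                exact ⟨⟨h1, fun h => by simpa using h3 j h⟩, h2⟩
              · rintro ⟨⟨h1, h2⟩, h3⟩
                refine ⟨⟨h1, h3⟩, fun s hs => ?_⟩
                rw [Function.update_of_ne (by rintro rfl; exact h2 hs)]
                omega
            have e2 : ∀ c ∈ A.erase j, (A.powersetCard r).filter (fun S => ∀ s ∈ S,
                Function.update (fun c => pos c + 1) j 0 c
                  < Function.update (fun c => pos c + 1) j 0 s)
                = ((A.erase j).powersetCard r).filter (fun S => ∀ s ∈ S, pos c < pos s) := by
              intro c hc
              ext S
              simp only [Finset.mem_filter, Finset.mem_powersetCard, Finset.subset_erase,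
                Function.update_of_ne (Finset.ne_of_mem_erase hc)]
              constructor
              · rintro ⟨⟨h1, h2⟩, h3⟩
                have hjS : j ∉ S := fun h => by simpa using h3 j h
                refine ⟨⟨⟨h1, hjS⟩, h2⟩, fun s hs => ?_⟩
                have := h3 s hs
                rw [Function.update_of_ne (by rintro rfl; exact hjS hs)] at this
                omega
              · rintro ⟨⟨⟨h1, h2⟩, h3⟩, h4⟩
                refine ⟨⟨h1, h3⟩, fun s hs => ?_⟩
                rw [Function.update_of_ne (by rintro rfl; exact h2 hs)]
                have := h4 s hs
                omega
            have e3 := Finset.sum_congr rfl fun c hc =>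
              congrArg (fun U => x c * ∑ S ∈ U, a S) (e2 c hc)
            rw [e1, e3] at h1
            unfold subsetSum
            linarith
        rw [symmSum_erase x hj]
        linarith
      -- Summing over `j` produces the same factor |A| - r > 0 on both sides.
      have h := Finset.sum_le_sum key
      rw [← Finset.sum_mul, ← Finset.mul_sum, sum_subsetSum_erase] at h
      have h2 : ∑ c ∈ A, symmSum x (A.erase c) r = ((A.card : ℝ) - r) * symmSum x A r :=
        sum_subsetSum_erase _ A r
      rw [h2] at h
      have h3 : (0 : ℝ) < (A.card : ℝ) - r := sub_pos.2 (by exact_mod_cast hr)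
      refine le_of_mul_le_mul_left ?_ h3
      linarith
    · rw [symmSum_eq_zero x (show A.card < r + 1 by omega), mul_zero]
      refine mul_nonneg (le_trans ?_ (hT fun _ => 0)) (symmSum_nonneg hx _ _)
      exact Finset.sum_nonneg fun c _ => mul_nonneg (hx c) (Finset.sum_nonneg fun S _ => ha S)

end SymmetricSums

/-! ### Lower bound: acyclic side information. -/

section Converse

variable {N Λ : ℕ}

/-- A broadcast that serves `d` has at least as many bits as there are pairs of a requested file
and one of its bits that is stored only in caches ranked after some cache whose users request it. -/
theorem card_le_of_deliveryScheme (Z : Placement N Λ) {L : Fin Λ → ℕ} {d : Demand N L} {ℓ : ℕ}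
    (D : Z.DeliveryScheme L d ℓ) (pos : Fin Λ → ℕ) (P : Finset (Fin N × Fin Z.fileBits))
    (hP : ∀ p ∈ P, ∃ u : User L, d u = p.1 ∧ ∀ s ∈ Z.stored p.1 p.2, pos u.1 < pos s) :
    P.card ≤ ℓ := by
  classical
  let ext : (P → Bool) → Library N Z.fileBits :=
    fun g n b => if h : (n, b) ∈ P then g ⟨(n, b), h⟩ else false
  have hinj : Function.Injective fun g => D.encode (ext g) := by
    intro g g' hg
    -- Induction on the rank: a bit of `P` cached by `u` belongs to a file requested by a user of
    -- smaller rank, where both libraries already agree; bits outside `P` are constantly `false`.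
    -- Equal broadcasts and equal cache contents then decode to equal files.
    have main : ∀ k : ℕ, ∀ u : User L, pos u.1 = k → ext g (d u) = ext g' (d u) := by
      intro k
      induction k using Nat.strong_induction_on with
      | _ k ih =>
        intro u hu
        have hc : Z.content (ext g) u.1 = Z.content (ext g') u.1 := by
          funext ⟨⟨n, b⟩, hp⟩
          change ext g n b = ext g' n b
          by_cases hmem : (n, b) ∈ P
          · obtain ⟨v, hv, hs⟩ := hP _ hmem
            have hlt := hs u.1 (by simpa [Placement.bitsOf] using hp)
            have := ih (pos v.1) (hu ▸ hlt) v rfl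
            simp only at hv
            rw [hv] at this
            rw [this]
          · simp [ext, hmem]
        have hg' : D.encode (ext g) = D.encode (ext g') := hg
        rw [← D.correct (ext g) u, ← D.correct (ext g') u, hc, hg']
    funext ⟨⟨n, b⟩, hp⟩
    obtain ⟨u, hu, -⟩ := hP _ hp
    have h := congrFun (main _ u rfl) b
    simp only at hu
    rw [hu] at h
    simpa [ext, hp] using h
  have hcard := Fintype.card_le_of_injective _ hinj
  simp only [Fintype.card_fun, Fintype.card_bool, Fintype.card_coe, Fintype.card_fin] at hcard
  exact (Nat.pow_le_pow_iff_right (by norm_num)).1 hcard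

/-- Injectivity of the demand makes the bits counted for different users disjoint, so the acyclic
bound is a sum over users. -/
theorem sum_card_le_minBits (Z : Placement N Λ) {L : Fin Λ → ℕ} {d : Demand N L}
    (hd : Function.Injective d) (pos : Fin Λ → ℕ) :
    ∑ u : User L, (Finset.univ.filter fun b => ∀ s ∈ Z.stored (d u) b, pos u.1 < pos s).card
      ≤ Z.minBits L d := by
  classical
  obtain ⟨D⟩ := Z.minBits_spec L d
  let P : Finset (Fin N × Fin Z.fileBits) := Finset.univ.biUnion fun u : User L =>
    (Finset.univ.filter fun b => ∀ s ∈ Z.stored (d u) b, pos u.1 < pos s).image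
      fun b => (d u, b)
  have h := card_le_of_deliveryScheme Z D pos P fun p hp => by
    obtain ⟨u, -, hu⟩ := Finset.mem_biUnion.1 hp
    obtain ⟨b, hb, rfl⟩ := Finset.mem_image.1 hu
    exact ⟨u, rfl, (Finset.mem_filter.1 hb).2⟩
  refine le_trans (le_of_eq ?_) h
  rw [Finset.card_biUnion]
  · refine Finset.sum_congr rfl fun u _ => (Finset.card_image_of_injective _ ?_).symm
    intro b b' hbb
    simpa using hbb
  · intro u _ v _ huv
    change Disjoint _ _
    rw [Finset.disjoint_left]
    intro p hp hp'
    obtain ⟨b, -, rfl⟩ := Finset.mem_image.1 hp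
    obtain ⟨b', -, h⟩ := Finset.mem_image.1 hp'
    exact huv (hd (Prod.ext_iff.1 h).1).symm

theorem minBits_le_worstCaseTime (Z : Placement N Λ) (L : Fin Λ → ℕ) (d : Demand N L) :
    (Z.minBits L d : ℝ) ≤ Z.worstCaseTime L * Z.fileBits := by
  have hB : (0 : ℝ) < Z.fileBits := by exact_mod_cast Z.fileBits_pos
  rw [← div_le_iff₀ hB]
  exact le_ciSup (f := fun d => Z.deliveryTime L d) (Set.finite_range _).bddAbove d

theorem worstCaseTime_nonneg (Z : Placement N Λ) (L : Fin Λ → ℕ) : 0 ≤ Z.worstCaseTime L :=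
  Real.iSup_nonneg fun _ => div_nonneg (Nat.cast_nonneg _) (Nat.cast_nonneg _)

/-- The average over the library of the acyclic bound for one ranking of the caches. -/
theorem sum_rank_le_worstCaseTime [NeZero N] (Z : Placement N Λ) {L : Fin Λ → ℕ}
    (hN : ∑ c, L c ≤ N) (pos : Fin Λ → ℕ) :
    ∑ c, (L c : ℝ) * ((Finset.univ.filter fun p : Fin N × Fin Z.fileBits =>
      ∀ s ∈ Z.stored p.1 p.2, pos c < pos s).card : ℝ)
      ≤ N * (Z.worstCaseTime L * Z.fileBits) := by
  obtain ⟨d⟩ : Nonempty (User L ↪ Fin N) := by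
    rw [Function.Embedding.nonempty_iff_card_le]
    simpa using hN
  let g : Fin Λ → Fin N → ℝ := fun c n =>
    ((Finset.univ.filter fun b => ∀ s ∈ Z.stored n b, pos c < pos s).card : ℝ)
  -- Shifting by `k` modulo `N` keeps the demand injective, and over all `k` each user requests
  -- every file exactly once.
  have h1 : ∀ k : Fin N, ∑ u : User L, g u.1 (d u + k) ≤ Z.worstCaseTime L * Z.fileBits := by
    intro k
    refine le_trans ?_ (minBits_le_worstCaseTime Z L fun u => d u + k)
    have := sum_card_le_minBits Z (d := fun u => d u + k)
      (fun u v h => d.injective (add_right_cancel h)) pos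
    simp only [g]
    exact_mod_cast this
  have h2 := Finset.sum_le_sum fun k (_ : k ∈ (Finset.univ : Finset (Fin N))) => h1 k
  rw [Finset.sum_const, Finset.card_univ, Fintype.card_fin, nsmul_eq_mul, Finset.sum_comm] at h2
  refine le_trans (le_of_eq ?_) h2
  have h3 : ∀ u : User L, ∑ k, g u.1 (d u + k) = ∑ n, g u.1 n := fun u =>
    Equiv.sum_comp (Equiv.addLeft (d u)) (g u.1)
  rw [Finset.sum_congr rfl fun u _ => h3 u, Fintype.sum_sigma]
  refine Finset.sum_congr rfl fun c _ => ?_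
  change _ = ∑ _i : Fin (L c), ∑ n, g c n
  rw [Finset.sum_const, Finset.card_univ, Fintype.card_fin, nsmul_eq_mul]
  congr 1
  rw [← Nat.cast_sum, Nat.cast_inj, Finset.card_filter, Fintype.sum_prod_type]
  exact Finset.sum_congr rfl fun n _ => (Finset.card_filter _ _).symm

theorem symmSum_div_le_worstCaseTime [NeZero N] (Z : Placement N Λ) {L : Fin Λ → ℕ}
    (hN : ∑ c, L c ≤ N) (hL : ∀ c, 0 < L c) {r : ℕ} (hr : r ≤ Λ)
    (hZ : ∀ n b, (Z.stored n b).card = r) :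
    symmSum (fun c => (L c : ℝ)) Finset.univ (r + 1) / symmSum (fun c => (L c : ℝ)) Finset.univ r
      ≤ Z.worstCaseTime L := by
  have hB : (0 : ℝ) < Z.fileBits := by exact_mod_cast Z.fileBits_pos
  have hN0 : (0 : ℝ) < N := by exact_mod_cast Nat.pos_of_ne_zero (NeZero.ne N)
  -- The mass of `S` is the number of library bits stored at exactly the caches in `S`; regularity
  -- puts the total mass `N * Z.fileBits` on `r`-sets.
  let a : Finset (Fin Λ) → ℝ := fun S =>
    ((Finset.univ.filter fun p : Fin N × Fin Z.fileBits => Z.stored p.1 p.2 = S).card : ℝ)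
  have hsum : ∀ (p : Finset (Fin Λ) → Prop) [DecidablePred p],
      ∑ S ∈ (Finset.univ : Finset (Fin Λ)).powersetCard r with p S, a S
        = ((Finset.univ.filter fun q : Fin N × Fin Z.fileBits =>
            p (Z.stored q.1 q.2)).card : ℝ) := by
    intro p _
    rw [Finset.card_eq_sum_card_fiberwise (f := fun q => Z.stored q.1 q.2)
      (t := (Finset.univ.powersetCard r).filter p), Nat.cast_sum]
    · refine Finset.sum_congr rfl fun S hS => ?_
      simp only [a, Nat.cast_inj]
      congr 1
      ext q
      simp only [Finset.mem_filter, Finset.mem_univ, true_and]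
      constructor
      · rintro rfl
        exact ⟨(Finset.mem_filter.1 hS).2, rfl⟩
      · exact fun h => h.2
    · intro q hq
      simp only [Finset.coe_filter, Finset.mem_univ, true_and, Set.mem_ofPred_eq] at hq
      simp [hZ, hq]
  have hmass : subsetSum a Finset.univ r = N * Z.fileBits := by
    have := hsum (fun _ => True)
    simpa [subsetSum] using this
  have key := subsetSum_mul_symmSum_le (x := fun c => (L c : ℝ)) (fun c => Nat.cast_nonneg _)
    (a := a) (fun S => Nat.cast_nonneg _) r Finset.univ
    (N * (Z.worstCaseTime L * Z.fileBits)) fun pos => by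
      refine le_trans (le_of_eq ?_) (sum_rank_le_worstCaseTime Z hN pos)
      refine Finset.sum_congr rfl fun c _ => ?_
      have h := hsum fun S => ∀ s ∈ S, pos c < pos s
      convert congrArg (fun z => (L c : ℝ) * z) h
  rw [hmass] at key
  rw [div_le_iff₀ (symmSum_pos (fun c => by exact_mod_cast hL c) (by simpa using hr))]
  refine le_of_mul_le_mul_left ?_ (mul_pos hN0 hB)
  linarith

theorem sum_load (Z : Placement N Λ) {r : ℕ} (hZ : ∀ n b, (Z.stored n b).card = r) :
    ∑ c, Z.load c = r * N := by
  have hB : (Z.fileBits : ℝ) ≠ 0 := by exact_mod_cast Z.fileBits_pos.ne'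
  simp only [Placement.load]
  rw [← Finset.sum_div, div_eq_iff hB]
  have h : ∑ c, (Z.bitsOf c).card = r * N * Z.fileBits := by
    simp only [Placement.bitsOf, Finset.card_filter]
    rw [Finset.sum_comm]
    have : ∀ p : Fin N × Fin Z.fileBits,
        ∑ c, (if c ∈ Z.stored p.1 p.2 then 1 else 0) = r := fun p => by
      rw [← hZ p.1 p.2]; simp
    rw [Finset.sum_congr rfl fun p _ => this p]
    simp only [Finset.sum_const, Finset.card_univ, Fintype.card_prod, Fintype.card_fin,
      smul_eq_mul]
    ring
  exact_mod_cast h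

theorem symmSum_div_le_of_mem {t : ℕ} {L : Fin Λ → ℕ} (hL : ∀ c, 0 < L c) (hN : ∑ c, L c ≤ N)
    (ht : t ≤ Λ) {T : ℝ} (hT : T ∈ regularUncodedTimes N t L) :
    symmSum (fun c => (L c : ℝ)) Finset.univ (t + 1) / symmSum (fun c => (L c : ℝ)) Finset.univ t
      ≤ T := by
  obtain ⟨M, Z, ⟨-, hM⟩, hload, ⟨r, hr⟩, rfl⟩ := hT
  rcases Nat.eq_zero_or_pos N with h0 | h0
  -- Without files there are no users, hence no caches, and the claimed bound is 0.
  · have hΛ : Λ = 0 := by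
      by_contra h
      have hc : Fin Λ := ⟨0, Nat.pos_of_ne_zero h⟩
      have h1 := hL hc
      have h2 := Finset.single_le_sum (f := L) (fun _ _ => Nat.zero_le _) (Finset.mem_univ hc)
      omega
    subst hΛ
    rw [symmSum_eq_zero _ (by simp), zero_div]
    exact worstCaseTime_nonneg Z L
  · have : NeZero N := ⟨h0.ne'⟩
    -- A placement need not fill the memory, so the multiplicity `r` may be below `t`;
    -- `symmSum_succ_div_antitone` covers this.
    have hrt : r ≤ t := by
      have h1 : (r : ℝ) * N ≤ t * N := by
        rw [← sum_load Z hr, ← hM]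
        exact Finset.sum_le_sum fun c _ => hload c
      exact_mod_cast le_of_mul_le_mul_right h1 (by exact_mod_cast h0)
    exact (symmSum_succ_div_antitone (fun c => by exact_mod_cast hL c) hrt
      (by simpa using ht)).trans (symmSum_div_le_worstCaseTime Z hN hL (hrt.trans ht) hr)

end Converse

/-! ### Upper bound: placement and XOR delivery indexed by selections of users. -/

section Achievability

variable {N Λ : ℕ}

/-- The caches at which a partial selection of users, at most one per cache, is defined. -/
def selSupport {L : Fin Λ → ℕ} (f : (c : Fin Λ) → Option (Fin (L c))) : Finset (Fin Λ) :=
  Finset.univ.filter fun c => f c ≠ none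

theorem mem_selSupport {L : Fin Λ → ℕ} {f : (c : Fin Λ) → Option (Fin (L c))} {c : Fin Λ} :
    c ∈ selSupport f ↔ f c ≠ none := by
  simp [selSupport]

/-- The selections of one user at each of `k` caches. -/
abbrev Selection (L : Fin Λ → ℕ) (k : ℕ) : Type :=
  {f : (c : Fin Λ) → Option (Fin (L c)) // (selSupport f).card = k}

theorem card_selSupport_eq (L : Fin Λ → ℕ) (S : Finset (Fin Λ)) :
    (Finset.univ.filter fun f : (c : Fin Λ) → Option (Fin (L c)) => selSupport f = S).card
      = ∏ c ∈ S, L c := by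
  have h : (Finset.univ.filter fun f : (c : Fin Λ) → Option (Fin (L c)) => selSupport f = S)
      = Fintype.piFinset fun c => if c ∈ S then Finset.univ.erase none else {none} := by
    ext f
    simp only [Finset.mem_filter, Finset.mem_univ, true_and, Fintype.mem_piFinset, Finset.ext_iff,
      mem_selSupport]
    refine forall_congr' fun c => ?_
    by_cases hc : c ∈ S <;> simp [hc]
  rw [h, Fintype.card_piFinset, ← Finset.prod_subset (Finset.subset_univ S)]
  · exact Finset.prod_congr rfl fun c hc => by simp [hc]
  · exact fun c _ hc => by simp [hc]

theorem card_selection_filter (L : Fin Λ → ℕ) (k : ℕ) (p : Finset (Fin Λ) → Prop)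
    [DecidablePred p] :
    (Finset.univ.filter fun f : Selection L k => p (selSupport f.1)).card
      = ∑ S ∈ (Finset.univ : Finset (Fin Λ)).powersetCard k with p S, ∏ c ∈ S, L c := by
  rw [← Finset.card_map (Function.Embedding.subtype _), Finset.card_eq_sum_card_fiberwise
    (f := selSupport) (t := (Finset.univ.powersetCard k).filter p)]
  · refine Finset.sum_congr rfl fun S hS => ?_
    rw [← card_selSupport_eq]
    congr 1
    ext f
    obtain ⟨h1, h2⟩ := Finset.mem_filter.1 hS
    have h3 := (Finset.mem_powersetCard.1 h1).2
    simp only [Finset.mem_filter, Finset.mem_map, Finset.mem_univ, true_and,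
      Function.Embedding.subtype_apply]
    constructor
    · exact fun h => h.2
    · rintro rfl
      exact ⟨⟨⟨f, h3⟩, h2, rfl⟩, rfl⟩
  · intro f hf
    obtain ⟨⟨g, hg⟩, h, rfl⟩ := Finset.mem_map.1 (Finset.mem_coe.1 hf)
    have h' : p (selSupport g) := (Finset.mem_filter.1 h).2
    simp [hg, h']

theorem card_selection (L : Fin Λ → ℕ) (k : ℕ) :
    (Fintype.card (Selection L k) : ℝ) = symmSum (fun c => (L c : ℝ)) Finset.univ k := by
  have h := card_selection_filter L k fun _ => True
  simp only [Finset.filter_true, Finset.card_univ] at h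
  rw [h]
  simp [symmSum, subsetSum]

/-- These are the terms of e_{k+1} divisible by `L c`, found by removing the selections that avoid
`c`. -/
theorem card_selection_mem (L : Fin Λ → ℕ) (k : ℕ) (c : Fin Λ) :
    ((Finset.univ.filter fun f : Selection L (k + 1) => c ∈ selSupport f.1).card : ℝ)
      = L c * symmSum (fun c => (L c : ℝ)) (Finset.univ.erase c) k := by
  have h1 := card_selection_filter L (k + 1) fun S => c ∈ S
  have h2 := Finset.sum_filter_add_sum_filter_not
    ((Finset.univ : Finset (Fin Λ)).powersetCard (k + 1)) (fun S => c ∈ S)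
    fun S => ∏ c ∈ S, (L c : ℝ)
  have h3 := symmSum_erase (fun c => (L c : ℝ)) (Finset.mem_univ c) k
  have h4 : ((Finset.univ : Finset (Fin Λ)).powersetCard (k + 1)).filter (fun S => c ∉ S)
      = (Finset.univ.erase c).powersetCard (k + 1) := by
    ext S
    simp only [Finset.mem_powersetCard, Finset.mem_filter, Finset.subset_erase]
    tauto
  rw [h4] at h2
  rw [h1]
  push_cast
  unfold symmSum subsetSum at h3 ⊢
  linarith

theorem selSupport_update_none {L : Fin Λ → ℕ} (f : (c : Fin Λ) → Option (Fin (L c)))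
    (c : Fin Λ) : selSupport (Function.update f c none) = (selSupport f).erase c := by
  ext x
  rw [Finset.mem_erase, mem_selSupport, mem_selSupport]
  by_cases h : x = c
  · subst h; simp
  · simp [h]

theorem selSupport_update_some {L : Fin Λ → ℕ} (f : (c : Fin Λ) → Option (Fin (L c)))
    (c : Fin Λ) (i : Fin (L c)) :
    selSupport (Function.update f c (some i)) = insert c (selSupport f) := by
  ext x
  rw [Finset.mem_insert, mem_selSupport, mem_selSupport]
  by_cases h : x = c
  · subst h; simp
  · simp [h]

/-- A selection with the user at cache `c` dropped. -/
def Selection.drop {L : Fin Λ → ℕ} {k : ℕ} (f : Selection L (k + 1)) (c : Fin Λ)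
    (hc : c ∈ selSupport f.1) : Selection L k :=
  ⟨Function.update f.1 c none, by
    rw [selSupport_update_none, Finset.card_erase_of_mem hc, f.2, Nat.add_sub_cancel]⟩

/-- A selection with the user `i` of cache `c` added. -/
def Selection.add {L : Fin Λ → ℕ} {k : ℕ} (f : Selection L k) (c : Fin Λ) (i : Fin (L c))
    (hc : c ∉ selSupport f.1) : Selection L (k + 1) :=
  ⟨Function.update f.1 c (some i), by
    rw [selSupport_update_some, Finset.card_insert_of_notMem hc, f.2]⟩

theorem Selection.drop_add {L : Fin Λ → ℕ} {k : ℕ} (f : Selection L k) (c : Fin Λ) (i : Fin (L c))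
    (hc : c ∉ selSupport f.1) (h : c ∈ selSupport (f.add c i hc).1) :
    (f.add c i hc).drop c h = f := by
  apply Subtype.ext
  have : f.1 c = none := by simpa [mem_selSupport] using hc
  simp [Selection.drop, Selection.add, ← this]

/-- The placement that splits every file into one bit per selection of users at `t` caches, and
stores this bit at these caches. -/
def selectionPlacement (N : ℕ) (L : Fin Λ → ℕ) (t : ℕ) (h : 0 < Fintype.card (Selection L t)) :
    Placement N Λ where
  fileBits := Fintype.card (Selection L t)
  fileBits_pos := h
  stored _ b := selSupport ((Fintype.equivFin (Selection L t)).symm b).1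

variable {L : Fin Λ → ℕ} {t : ℕ}

theorem isRegular_selectionPlacement (h : 0 < Fintype.card (Selection L t)) :
    (selectionPlacement N L t h).IsRegular :=
  ⟨t, fun _ b => ((Fintype.equivFin (Selection L t)).symm b).2⟩

theorem load_selectionPlacement (h : 0 < Fintype.card (Selection L t)) (c : Fin Λ) :
    (selectionPlacement N L t h).load c =
      ((Finset.univ.filter fun f : Selection L t => c ∈ selSupport f.1).card : ℝ)
        / Fintype.card (Selection L t) * N := by
  have e : ((selectionPlacement N L t h).bitsOf c).card
      = N * (Finset.univ.filter fun f : Selection L t => c ∈ selSupport f.1).card := by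
    rw [Placement.bitsOf, Finset.card_filter, Fintype.sum_prod_type, Finset.card_filter]
    have e1 : ∀ n : Fin N, ∑ b, (if c ∈ (selectionPlacement N L t h).stored n b then 1 else 0)
        = ∑ f : Selection L t, if c ∈ selSupport f.1 then 1 else 0 := fun n =>
      Equiv.sum_comp (Fintype.equivFin (Selection L t)).symm
        fun f => if c ∈ selSupport f.1 then 1 else 0
    rw [Finset.sum_congr rfl fun n _ => e1 n, Finset.sum_const, Finset.card_univ,
      Fintype.card_fin, smul_eq_mul]
  change (((selectionPlacement N L t h).bitsOf c).card : ℝ) / (Fintype.card (Selection L t) : ℝ) = _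
  rw [e]
  push_cast
  ring

/-- The part that the user of `f` at cache `c` needs of the message of the selection `f`. -/
def messageTerm {L : Fin Λ → ℕ} {t : ℕ} (V : User L → Selection L t → Bool)
    (f : Selection L (t + 1)) (c : Fin Λ) : ZMod 2 :=
  if h : c ∈ selSupport f.1 then
    if V ⟨c, (f.1 c).get (Option.isSome_iff_ne_none.2 (mem_selSupport.1 h))⟩ (f.drop c h)
    then 1 else 0
  else 0

/-- For every selection `f` of users at `t + 1` caches, broadcast the sum modulo 2 over these
users of the requested bits that belong to the selection of the other users. -/
theorem nonempty_deliveryScheme (h : 0 < Fintype.card (Selection L t)) (d : Demand N L) :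
    Nonempty ((selectionPlacement N L t h).DeliveryScheme L d
      (Fintype.card (Selection L (t + 1)))) := by
  classical
  let e : Selection L t ≃ Fin (selectionPlacement N L t h).fileBits := Fintype.equivFin _
  let e' : Selection L (t + 1) ≃ Fin (Fintype.card (Selection L (t + 1))) := Fintype.equivFin _
  have hmem : ∀ (n : Fin N) (f : Selection L t) (c : Fin Λ), c ∈ selSupport f.1 →
      (n, e f) ∈ (selectionPlacement N L t h).bitsOf c := by
    intro n f c hc
    refine Finset.mem_filter.2 ⟨Finset.mem_univ _, ?_⟩
    change c ∈ selSupport (e.symm (e f)).1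
    rwa [e.symm_apply_apply]
  refine ⟨{
    encode := fun W i => decide
      (∑ c, messageTerm (fun u f => W (d u) (e f)) (e'.symm i) c = 1)
    decode := fun u x y b =>
      if hb : u.1 ∈ selSupport (e.symm b).1 then
        y ⟨(d u, b), e.apply_symm_apply b ▸ hmem (d u) (e.symm b) u.1 hb⟩
      else
        decide ((if x (e' ((e.symm b).add u.1 u.2 hb)) then (1 : ZMod 2) else 0)
          - ∑ c ∈ Finset.univ.erase u.1,
            messageTerm (fun v f => if hv : u.1 ∈ selSupport f.1 then
              y ⟨(d v, e f), hmem (d v) f u.1 hv⟩ else false) ((e.symm b).add u.1 u.2 hb) c = 1)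
    correct := ?_ }⟩
  intro W u
  funext b
  by_cases hb : u.1 ∈ selSupport (e.symm b).1
  · simp only [hb, dif_pos]
    rfl
  · simp only [hb, dif_neg, not_false_eq_true, e'.symm_apply_apply]
    set f := (e.symm b).add u.1 u.2 hb with hf
    have huf : u.1 ∈ selSupport f.1 := by
      rw [hf]
      simp [Selection.add, selSupport_update_some]
    have hbit : ∀ z : ZMod 2, (if decide (z = 1) = true then (1 : ZMod 2) else 0) = z := by decide
    rw [hbit]
    -- Dropping a user at a cache other than `u.1` keeps `u.1` in the support, so every interfering
    -- bit is cached and the default `false` of the decoder is never used.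
    have hsum : ∑ c ∈ Finset.univ.erase u.1,
            messageTerm (fun v f => if hv : u.1 ∈ selSupport f.1 then
              (selectionPlacement N L t h).content W u.1 ⟨(d v, e f), hmem (d v) f u.1 hv⟩
              else false) f c
        = ∑ c ∈ Finset.univ.erase u.1, messageTerm (fun u f => W (d u) (e f)) f c := by
      refine Finset.sum_congr rfl fun c hc => ?_
      unfold messageTerm
      by_cases hcf : c ∈ selSupport f.1
      · have hu : u.1 ∈ selSupport (f.drop c hcf).1 := by
          change u.1 ∈ selSupport (Function.update f.1 c none)
          rw [selSupport_update_none]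
          exact Finset.mem_erase.2 ⟨(Finset.ne_of_mem_erase hc).symm, huf⟩
        simp only [hcf, hu, dif_pos]
        rfl
      · simp only [hcf, dif_neg, not_false_eq_true]
    rw [hsum, ← Finset.add_sum_erase _ _ (Finset.mem_univ u.1), add_sub_cancel_right]
    have hterm : messageTerm (fun u f => W (d u) (e f)) f u.1
        = if W (d u) b then 1 else 0 := by
      unfold messageTerm
      rw [dif_pos huf]
      have h1 : f.drop u.1 huf = e.symm b := Selection.drop_add _ _ _ hb huf
      have h2 : (f.1 u.1).get (Option.isSome_iff_ne_none.2 (mem_selSupport.1 huf)) = u.2 := by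
        have : f.1 u.1 = some u.2 := by rw [hf]; simp [Selection.add]
        simp [this]
      rw [h1, h2]
      simp only [e.apply_symm_apply]
    rw [hterm]
    cases W (d u) b <;> simp

theorem worstCaseTime_selectionPlacement_le (h : 0 < Fintype.card (Selection L t)) :
    (selectionPlacement N L t h).worstCaseTime L
      ≤ (Fintype.card (Selection L (t + 1)) : ℝ) / Fintype.card (Selection L t) := by
  refine Real.iSup_le (fun d => ?_) (by positivity)
  refine div_le_div_of_nonneg_right ?_ (Nat.cast_nonneg _)
  exact_mod_cast Nat.sInf_le (nonempty_deliveryScheme h d)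

end Achievability

/-! ### Closed forms for the cache sizes and the delivery time. -/

section Parameters

variable {Λ : ℕ} {L : Fin Λ → ℕ} {t : ℕ}

theorem elemSymm_eq (L : Fin Λ → ℕ) (s : Finset (Fin Λ)) (k : ℕ) :
    elemSymm L s k = symmSum (fun c => (L c : ℝ)) s k :=
  Finset.esymm_map_val _ _ _

theorem gamma_nonneg (L : Fin Λ → ℕ) (t : ℕ) (c : Fin Λ) : 0 ≤ gamma t L c := by
  rcases t with _ | t
  · exact le_rfl
  · simp only [gamma, elemSymm_eq]
    have h := symmSum_nonneg (x := fun c => (L c : ℝ)) fun c => Nat.cast_nonneg _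
    exact div_nonneg (mul_nonneg (Nat.cast_nonneg _) (h _ _)) (h _ _)

theorem one_sub_gamma (hL : ∀ c, 0 < L c) (ht : t ≤ Λ) (c : Fin Λ) :
    1 - gamma t L c = symmSum (fun c => (L c : ℝ)) (Finset.univ.erase c) t
      / symmSum (fun c => (L c : ℝ)) Finset.univ t := by
  have hpos := symmSum_pos (x := fun c => (L c : ℝ)) (fun c => by exact_mod_cast hL c)
    (A := Finset.univ) (k := t) (by simpa using ht)
  rcases t with _ | t
  · simp [gamma, symmSum_zero]
  · simp only [gamma, elemSymm_eq]
    rw [eq_div_iff hpos.ne', sub_mul, div_mul_cancel₀ _ hpos.ne',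
      symmSum_erase _ (Finset.mem_univ c)]
    ring

theorem sum_gamma (hL : ∀ c, 0 < L c) (ht : t ≤ Λ) : ∑ c, gamma t L c = t := by
  have hpos := symmSum_pos (x := fun c => (L c : ℝ)) (fun c => by exact_mod_cast hL c)
    (A := Finset.univ) (k := t) (by simpa using ht)
  rcases t with _ | t
  · simp [gamma]
  · simp only [gamma, elemSymm_eq]
    rw [← Finset.sum_div, sum_mul_symmSum_erase, mul_div_cancel_right₀ _ hpos.ne']
    push_cast
    rfl

/-- Since 1 - γ_c = e_t(L∖L_c)/e_t(L), the numerator counts each monomial of e_{t+1} once per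
factor, which cancels t + 1. -/
theorem achievableTime_eq (hL : ∀ c, 0 < L c) (ht : t ≤ Λ) :
    achievableTime t L = symmSum (fun c => (L c : ℝ)) Finset.univ (t + 1)
      / symmSum (fun c => (L c : ℝ)) Finset.univ t := by
  unfold achievableTime
  simp only [one_sub_gamma hL ht, ← mul_div_assoc]
  rw [← Finset.sum_div, sum_mul_symmSum_erase, div_right_comm, mul_div_cancel_left₀]
  positivity

theorem isMemoryAllocation_gamma (N : ℕ) (hL : ∀ c, 0 < L c) (ht : t ≤ Λ) :
    IsMemoryAllocation N t fun c => gamma t L c * N := by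
  refine ⟨fun c => ⟨mul_nonneg (gamma_nonneg L t c) (Nat.cast_nonneg _), ?_⟩, ?_⟩
  · have h := symmSum_nonneg (x := fun c => (L c : ℝ)) fun c => Nat.cast_nonneg _
    have h1 : 0 ≤ 1 - gamma t L c := by
      rw [one_sub_gamma hL ht]
      exact div_nonneg (h _ _) (h _ _)
    exact mul_le_of_le_one_left (Nat.cast_nonneg _) (by linarith)
  · rw [← Finset.sum_mul, sum_gamma hL ht]

theorem gamma_pos (hL : ∀ c, 0 < L c) (ht : t ≤ Λ) (h1 : 1 ≤ t) (c : Fin Λ) :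
    0 < gamma t L c := by
  have hL' : ∀ c, (0 : ℝ) < L c := fun c => by exact_mod_cast hL c
  obtain ⟨s, rfl⟩ : ∃ s, t = s + 1 := ⟨t - 1, by omega⟩
  simp only [gamma, elemSymm_eq]
  refine div_pos (mul_pos (hL' c) (symmSum_pos hL' ?_)) (symmSum_pos hL' (by simpa using ht))
  rw [Finset.card_erase_of_mem (Finset.mem_univ c), Finset.card_univ, Fintype.card_fin]
  omega

/-- The ratio γ_c is the fraction of selections that involve cache `c`. -/
theorem load_selectionPlacement_eq_gamma (N : ℕ) (h : 0 < Fintype.card (Selection L t))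
    (c : Fin Λ) : (selectionPlacement N L t h).load c = gamma t L c * N := by
  rw [load_selectionPlacement]
  congr 1
  rcases t with _ | t
  · have : ∀ f : Selection L 0, c ∉ selSupport f.1 := fun f => by
      simp [Finset.card_eq_zero.1 f.2]
    simp [gamma, this]
  · rw [card_selection_mem, card_selection, gamma, elemSymm_eq, elemSymm_eq]

end Parameters

end SharedCache

end

theorem theorem3 {Λ N t : ℕ} (L : Fin Λ → ℕ) (hL : ∀ c, 0 < L c) (hN : ∑ c, L c ≤ N)
    (ht : t ≤ Λ) :
    IsLeast (SharedCache.regularUncodedTimes N t L) (SharedCache.achievableTime t L) ∧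
    SharedCache.achievableTime t L =
      SharedCache.elemSymm L Finset.univ (t + 1) / SharedCache.elemSymm L Finset.univ t ∧
    SharedCache.IsMemoryAllocation N t (fun c => SharedCache.gamma t L c * N) ∧
    (1 ≤ t → ∀ c, 0 < SharedCache.gamma t L c) ∧
    (∃ Z : SharedCache.Placement N Λ, Z.IsRegular ∧
      (∀ c, Z.load c = SharedCache.gamma t L c * N) ∧
      Z.worstCaseTime L = SharedCache.achievableTime t L) := by
  open SharedCache in
  have hcard : 0 < Fintype.card (Selection L t) := by
    have h := symmSum_pos (x := fun c => (L c : ℝ)) (fun c => by exact_mod_cast hL c)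
      (A := Finset.univ) (k := t) (by simpa using ht)
    rw [← card_selection] at h
    exact_mod_cast h
  have hmem : (selectionPlacement N L t hcard).worstCaseTime L ∈ regularUncodedTimes N t L :=
    ⟨_, _, isMemoryAllocation_gamma N hL ht,
      fun c => (load_selectionPlacement_eq_gamma N hcard c).le,
      isRegular_selectionPlacement hcard, rfl⟩
  have hlow : ∀ T ∈ regularUncodedTimes N t L, achievableTime t L ≤ T := fun T hT => by
    rw [achievableTime_eq hL ht]
    exact symmSum_div_le_of_mem hL hN ht hT
  have heq : (selectionPlacement N L t hcard).worstCaseTime L = achievableTime t L := by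
    refine le_antisymm ?_ (hlow _ hmem)
    rw [achievableTime_eq hL ht, ← card_selection, ← card_selection]
    exact worstCaseTime_selectionPlacement_le hcard
  refine ⟨⟨heq ▸ hmem, hlow⟩, ?_, isMemoryAllocation_gamma N hL ht, gamma_pos hL ht,
    selectionPlacement N L t hcard, isRegular_selectionPlacement hcard,
    load_selectionPlacement_eq_gamma N hcard, heq⟩
  rw [elemSymm_eq, elemSymm_eq, achievableTime_eq hL ht]
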